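/- Let $\mathfrak g=(\mathfrak{sl}_2\otimes\mathbb C[t,t^{-1}])\oplus\mathbb Cc\oplus\mathbb Cd$ be the affine Kac–Moody Lie algebra of type $A_1^{(1)}$, with Cartan subalgebra $\mathfrak h=\mathbb C\alpha^\vee\oplus\mathbb Cc\oplus\mathbb Cd$ and $\mathfrak h^*=\mathbb C\Lambda_0\oplus\mathbb C\alpha\oplus\mathbb C\delta$, where $\alpha$ is the simple root of $\mathfrak{sl}_2$ (zero on $c$, $d$), $\Lambda_0(c)=\delta(d)=1$, and $\Lambda_0$, $\delta$ vanish on the other basis elements. The simple roots are $\alpha_0=\delta-\alpha$, $\alpha_1=\alpha$, the simple coroots are $\alpha_0^\vee=c-\alpha^\vee$, $\alpha_1^\vee=\alpha^\vee$, and $\rho=2\Lambda_0+\frac12\alpha$. Let $W$ be the Weyl group acting on $\mathfrak h^*$, generated by the reflections $s_i(\mu)=\mu-\mu(\alpha_i^\vee)\alpha_i$ $(i=0,1)$, let $\ell$ be its length function and $\varepsilon(w)=(-1)^{\ell(w)}$, and let $\pi:\mathfrak h^*\to\mathbb C\Lambda_0\oplus\mathbb C\alpha$ be the projection along $\mathbb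 C\delta$. Let $m',m''\ge 1$ be integers, $m=m'+m''$, and let $j,j',j''$ be integers with $0\le j\le m$, $0\le j'\le m'$, $0\le j''\le m''$ and $\frac{j-j'-j''}2\in\mathbb Z$. Put $$\Lambda=m\Lambda_0+\tfrac j2\alpha,\qquad \Lambda'=m'\Lambda_0+\tfrac{j'}2\alpha,\qquad \Lambda''=m''\Lambda_0+\tfrac{j''}2\alpha .$$ Let $L(\Lambda')$ be the irreducible highest weight $\mathfrak g$-module with highest weight $\Lambda'$, and let $P^o(\Lambda')$ be the set of its $\delta$-maximal weights, i.e. of the weights $\lambda$ of $L(\Lambda')$ such that $\lambda+n\delta$ is not a weight of $L(\Lambda')$ for any integer $n>0$. Let $T_\Lambda^{\Lambda',\Lambda''}$ be the set of all $\lambda\in P^o(\Lambda')$ for which there are $v_{\Lambda,\Lambda'',\lambda}\in W$ and $S_{\Lambda,\Lambda'',\lambda}\in\mathbb Z$ (necessarily unique) with $$\lambda+\Lambda''+\rho=v_{\Lambda,\Lambda'',\lambda}(\Lambda+\rho)+S_{\Lambda,\Lambda'',\lambda}\,\delta .$$ Then the set $$\{S_{\Lambda,\Lambda'',\lambda}:\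 \lambda\in T_\Lambda^{\Lambda',\Lambda''},\ \varepsilon(v_{\Lambda,\Lambda'',\lambda})=1\}$$ has a maximum, and for $\lambda\in T_\Lambda^{\Lambda',\Lambda''}$ with $\varepsilon(v_{\Lambda,\Lambda'',\lambda})=1$ the value $S_{\Lambda,\Lambda'',\lambda}$ equals this maximum if and only if $\pi(\lambda)=\Lambda'+\frac12(j-j'-j'')\alpha$. -/

import Mathlib

open scoped TensorProduct

noncomputable section

namespace AffineSl2

/-! ### The affine Lie algebra `sl₂ ⊗ ℂ[t, t⁻¹] ⊕ ℂ c ⊕ ℂ d` -/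

/-- The Lie algebra `sl₂` of traceless complex `2 × 2` matrices. -/
def sl2 : Type := LieAlgebra.SpecialLinear.sl (Fin 2) ℂ

instance : LieRing sl2 := inferInstanceAs (LieRing (LieAlgebra.SpecialLinear.sl (Fin 2) ℂ))

instance : LieAlgebra ℂ sl2 :=
  inferInstanceAs (LieAlgebra ℂ (LieAlgebra.SpecialLinear.sl (Fin 2) ℂ))

/-- The matrix of an element of `sl₂`. -/
def toMatrix : sl2 →ₗ[ℂ] Matrix (Fin 2) (Fin 2) ℂ :=
  { toFun := Subtype.val, map_add' := fun _ _ => rfl, map_smul' := fun _ _ => rfl }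

theorem toMatrix_lie (x y : sl2) :
    toMatrix ⁅x, y⁆ = toMatrix x * toMatrix y - toMatrix y * toMatrix x := rfl

/-- The raising element of `sl₂`. -/
def e : sl2 :=
  ⟨!![0, 1; 0, 0], by simp [LieAlgebra.SpecialLinear.sl, Matrix.trace_fin_two]⟩

/-- The lowering element of `sl₂`. -/
def f : sl2 :=
  ⟨!![0, 0; 1, 0], by simp [LieAlgebra.SpecialLinear.sl, Matrix.trace_fin_two]⟩

/-- The simple coroot of `sl₂`. -/
def h : sl2 :=
  ⟨!![1, 0; 0, -1], by simp [LieAlgebra.SpecialLinear.sl, Matrix.trace_fin_two]⟩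

/-- The normalized invariant form `(x, y) ↦ tr (x y)` on `sl₂`. -/
def form : LinearMap.BilinForm ℂ sl2 :=
  LinearMap.mk₂ ℂ (fun x y => Matrix.trace (toMatrix x * toMatrix y))
    (fun x y z => by simp [add_mul])
    (fun a x y => by simp)
    (fun x y z => by simp [mul_add])
    (fun a x y => by simp)

@[simp] theorem toMatrix_e : toMatrix e = !![0, 1; 0, 0] := rfl
@[simp] theorem toMatrix_f : toMatrix f = !![0, 0; 1, 0] := rfl
@[simp] theorem toMatrix_h : toMatrix h = !![1, 0; 0, -1] := rfl

theorem toMatrix_injective : Function.Injective toMatrix := Subtype.val_injective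

theorem form_apply (x y : sl2) : form x y = Matrix.trace (toMatrix x * toMatrix y) := rfl

/-- The loop algebra `ℂ[t, t⁻¹] ⊗ sl₂`. -/
def Loop : Type := LieAlgebra.loopAlgebra ℂ ℤ sl2

instance : LieRing Loop := inferInstanceAs (LieRing (LieAlgebra.loopAlgebra ℂ ℤ sl2))

instance : LieAlgebra ℂ Loop :=
  inferInstanceAs (LieAlgebra ℂ (LieAlgebra.loopAlgebra ℂ ℤ sl2))

/-- The loop algebra as the space of finitely supported functions `ℤ → sl₂`. -/
def toFinsupp : Loop ≃ₗ[ℂ] (ℤ →₀ sl2) := LieAlgebra.LoopAlgebra.toFinsupp ℂ ℤ sl2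

/-- The element `x ⊗ t ^ n` of the loop algebra. -/
def loopPow (n : ℤ) (x : sl2) : Loop :=
  (AddMonoidAlgebra.single n (1 : ℂ) ⊗ₜ[ℂ] x : LieAlgebra.loopAlgebra ℂ ℤ sl2)

@[simp] theorem toFinsupp_loopPow (n : ℤ) (x : sl2) :
    toFinsupp (loopPow n x) = Finsupp.single n x :=
  LieAlgebra.LoopAlgebra.toFinsupp_single_tmul ℂ ℤ sl2 n x

@[simp] theorem toFinsupp_symm_single (n : ℤ) (x : sl2) :
    toFinsupp.symm (Finsupp.single n x) = loopPow n x := by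
  rw [LinearEquiv.symm_apply_eq, toFinsupp_loopPow]

theorem loop_induction {p : Loop → Prop} (g : Loop) (h0 : p 0)
    (h1 : ∀ n x, p (loopPow n x)) (h2 : ∀ a b, p a → p b → p (a + b)) : p g := by
  obtain ⟨g, rfl⟩ := toFinsupp.symm.surjective g
  induction g using Finsupp.induction_linear with
  | zero => simpa using h0
  | add a b ha hb => rw [map_add]; exact h2 _ _ ha hb
  | single n x => rw [toFinsupp_symm_single]; exact h1 n x

/-- The derivation `t d/dt` of the loop algebra, with `x ⊗ t ^ n ↦ n (x ⊗ t ^ n)`. -/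
def euler : Loop →ₗ[ℂ] Loop :=
  toFinsupp.symm.toLinearMap ∘ₗ
    Finsupp.lsum ℂ (fun n : ℤ => (n : ℂ) • Finsupp.lsingle n) ∘ₗ toFinsupp.toLinearMap

@[simp] theorem euler_loopPow (n : ℤ) (x : sl2) :
    euler (loopPow n x) = (n : ℂ) • loopPow n x := by
  simp [euler, -Finsupp.smul_single]

/-- The bilinear form with `(x ⊗ t ^ m, y ⊗ t ^ n) ↦ m δ_{m, -n} (x, y)`. -/
def cocycle : LinearMap.BilinForm ℂ Loop :=
  LinearMap.compl₁₂ (Finsupp.lsum ℂ (fun m : ℤ => (m : ℂ) •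
      ((LinearMap.lcomp ℂ ℂ (Finsupp.lapply (R := ℂ) (M := sl2) (-m))) ∘ₗ form)))
    toFinsupp.toLinearMap toFinsupp.toLinearMap

theorem cocycle_loopPow (m n : ℤ) (x y : sl2) :
    cocycle (loopPow m x) (loopPow n y) = if m + n = 0 then (m : ℂ) * form x y else 0 := by
  by_cases hmn : m + n = 0
  · obtain rfl : n = -m := by omega
    simp [cocycle]
  · have : n ≠ -m := by omega
    simp [cocycle, hmn, this]

@[simp] theorem loopPow_lie (m n : ℤ) (x y : sl2) :
    ⁅loopPow m x, loopPow n y⁆ = loopPow (m + n) ⁅x, y⁆ := by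
  have h := LieAlgebra.ExtendScalars.bracket_tmul ℂ (AddMonoidAlgebra ℂ ℤ) sl2 sl2
    (AddMonoidAlgebra.single m 1) (AddMonoidAlgebra.single n 1) x y
  rw [AddMonoidAlgebra.single_mul_single, one_mul] at h
  exact h

theorem form_symm (x y : sl2) : form x y = form y x :=
  Matrix.trace_mul_comm (toMatrix x) (toMatrix y)

theorem form_lie (x y z : sl2) : form ⁅x, y⁆ z = form x ⁅y, z⁆ := by
  simp only [form, LinearMap.mk₂_apply, toMatrix_lie, sub_mul, mul_sub, Matrix.trace_sub,
    mul_assoc]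
  rw [Matrix.trace_mul_comm (toMatrix y) (toMatrix x * toMatrix z), mul_assoc]

theorem cocycle_skew (g k : Loop) : cocycle g k = -cocycle k g := by
  induction g using loop_induction with
  | h0 => simp
  | h2 a a' ha ha' => simp only [map_add, LinearMap.add_apply, ha, ha']; ring
  | h1 l x =>
  induction k using loop_induction with
  | h0 => simp
  | h2 a a' ha ha' => simp only [map_add, LinearMap.add_apply, ha, ha']; ring
  | h1 m y =>
    rw [cocycle_loopPow, cocycle_loopPow, add_comm m l, form_symm y x]
    split_ifs with hlm
    · obtain rfl : m = -l := by omega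
      push_cast; ring
    · simp

theorem cocycle_self (g : Loop) : cocycle g g = 0 := by
  have h := cocycle_skew g g
  linear_combination h / 2

theorem cocycle_lie (a b c : Loop) :
    cocycle a ⁅b, c⁆ = cocycle ⁅a, b⁆ c + cocycle b ⁅a, c⁆ := by
  induction a using loop_induction with
  | h0 => simp
  | h2 a a' ha ha' => simp only [map_add, LinearMap.add_apply, add_lie, ha, ha']; ring
  | h1 l x =>
  induction b using loop_induction with
  | h0 => simp
  | h2 a a' ha ha' => simp only [map_add, LinearMap.add_apply, add_lie, lie_add, ha, ha']; ring
  | h1 m y =>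
  induction c using loop_induction with
  | h0 => simp
  | h2 a a' ha ha' => simp only [map_add, lie_add, ha, ha']; ring
  | h1 n z =>
  have e1 : form y ⁅x, z⁆ = - form x ⁅y, z⁆ := by
    rw [← form_lie, ← form_lie, ← lie_skew, map_neg, LinearMap.neg_apply]
  simp only [loopPow_lie, cocycle_loopPow, form_lie, e1]
  have e2 : m + (l + n) = l + (m + n) := by ring
  rw [e2, add_assoc]
  split_ifs
  · push_cast; ring
  · simp

theorem euler_lie (a b : Loop) : euler ⁅a, b⁆ = ⁅euler a, b⁆ + ⁅a, euler b⁆ := by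
  induction a using loop_induction with
  | h0 => simp
  | h2 a a' ha ha' => simp only [map_add, add_lie, ha, ha']; abel
  | h1 l x =>
  induction b using loop_induction with
  | h0 => simp
  | h2 a a' ha ha' => simp only [map_add, lie_add, ha, ha']; abel
  | h1 m y => simp [add_smul]

theorem cocycle_euler (a b : Loop) : cocycle (euler a) b + cocycle a (euler b) = 0 := by
  induction a using loop_induction with
  | h0 => simp
  | h2 a a' ha ha' =>
    simp only [map_add, LinearMap.add_apply]
    linear_combination ha + ha'
  | h1 l x =>
  induction b using loop_induction with
  | h0 => simp
  | h2 a a' ha ha' => simp only [map_add]; linear_combination ha + ha'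
  | h1 m y =>
    simp only [euler_loopPow, map_smul, LinearMap.smul_apply, cocycle_loopPow, smul_eq_mul]
    split_ifs with hlm
    · obtain rfl : m = -l := by omega
      push_cast; ring
    · simp

end AffineSl2

/-- The affine Lie algebra `sl₂ ⊗ ℂ[t, t⁻¹] ⊕ ℂ c ⊕ ℂ d` of type `A₁⁽¹⁾`; an element is given by
its component in the loop algebra and its coefficients along `c` and `d`. -/
@[ext] structure AffineSl2 : Type where
  /-- the component in the loop algebra -/
  loop : AffineSl2.Loop
  /-- the coefficient of the canonical central element `c` -/
  coeffC : ℂ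
  /-- the coefficient of the scaling element `d` -/
  coeffD : ℂ

namespace AffineSl2

/-- The underlying vector space. -/
def equivProd : AffineSl2 ≃ Loop × ℂ × ℂ where
  toFun x := (x.loop, x.coeffC, x.coeffD)
  invFun x := ⟨x.1, x.2.1, x.2.2⟩
  left_inv _ := rfl
  right_inv _ := rfl

instance : AddCommGroup AffineSl2 := equivProd.addCommGroup

instance : Module ℂ AffineSl2 := equivProd.module ℂ

@[simp] theorem loop_zero : (0 : AffineSl2).loop = 0 := rfl
@[simp] theorem coeffC_zero : (0 : AffineSl2).coeffC = 0 := rfl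
@[simp] theorem coeffD_zero : (0 : AffineSl2).coeffD = 0 := rfl
@[simp] theorem loop_add (x y : AffineSl2) : (x + y).loop = x.loop + y.loop := rfl
@[simp] theorem coeffC_add (x y : AffineSl2) : (x + y).coeffC = x.coeffC + y.coeffC := rfl
@[simp] theorem coeffD_add (x y : AffineSl2) : (x + y).coeffD = x.coeffD + y.coeffD := rfl
@[simp] theorem loop_neg (x : AffineSl2) : (-x).loop = -x.loop := rfl
@[simp] theorem coeffC_neg (x : AffineSl2) : (-x).coeffC = -x.coeffC := rfl
@[simp] theorem coeffD_neg (x : AffineSl2) : (-x).coeffD = -x.coeffD := rfl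
@[simp] theorem loop_smul (a : ℂ) (x : AffineSl2) : (a • x).loop = a • x.loop := rfl
@[simp] theorem coeffC_smul (a : ℂ) (x : AffineSl2) : (a • x).coeffC = a * x.coeffC := rfl
@[simp] theorem coeffD_smul (a : ℂ) (x : AffineSl2) : (a • x).coeffD = a * x.coeffD := rfl

/-- The bracket: `[x ⊗ t ^ m, y ⊗ t ^ n] = [x, y] ⊗ t ^ (m + n) + m δ_{m, -n} (x, y) c`,
`[d, x ⊗ t ^ n] = n (x ⊗ t ^ n)`, and `c` is central. -/
instance : Bracket AffineSl2 AffineSl2 where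
  bracket x y :=
    ⟨⁅x.loop, y.loop⁆ + x.coeffD • euler y.loop - y.coeffD • euler x.loop,
      cocycle x.loop y.loop, 0⟩

@[simp] theorem loop_lie (x y : AffineSl2) :
    ⁅x, y⁆.loop = ⁅x.loop, y.loop⁆ + x.coeffD • euler y.loop - y.coeffD • euler x.loop := rfl
@[simp] theorem coeffC_lie (x y : AffineSl2) : ⁅x, y⁆.coeffC = cocycle x.loop y.loop := rfl
@[simp] theorem coeffD_lie (x y : AffineSl2) : ⁅x, y⁆.coeffD = 0 := rfl

instance : LieRing AffineSl2 where
  add_lie x y z := by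
    ext1
    · simp only [loop_lie, loop_add, coeffD_add, add_lie, add_smul, map_add, smul_add]; abel
    · simp
    · simp
  lie_add x y z := by
    ext1
    · simp only [loop_lie, loop_add, coeffD_add, lie_add, add_smul, map_add, smul_add]; abel
    · simp
    · simp
  lie_self x := by
    ext1
    · simp
    · simpa using cocycle_self x.loop
    · simp
  leibniz_lie x y z := by
    ext1
    · simp only [loop_lie, loop_add, coeffD_lie, lie_add, lie_sub, add_lie, sub_lie, map_add,
        map_sub, map_smul, euler_lie, lie_smul, smul_lie, smul_add, smul_sub, zero_smul,
        leibniz_lie x.loop y.loop z.loop, smul_comm y.coeffD x.coeffD,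
        smul_comm z.coeffD x.coeffD, smul_comm z.coeffD y.coeffD]
      rw [← lie_skew (euler x.loop) y.loop]
      simp only [smul_neg]
      abel
    · simp only [coeffC_lie, coeffC_add, loop_lie, map_add, map_sub, map_smul,
        LinearMap.add_apply, LinearMap.sub_apply, LinearMap.smul_apply, smul_eq_mul,
        cocycle_lie x.loop y.loop z.loop]
      have h1 := cocycle_euler x.loop y.loop
      have h2 := cocycle_euler x.loop z.loop
      have h3 := cocycle_euler y.loop z.loop
      have h4 := cocycle_skew (euler x.loop) y.loop
      linear_combination (-z.coeffD) * h1 + z.coeffD * h4 + y.coeffD * h2 - x.coeffD * h3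
    · simp

instance : LieAlgebra ℂ AffineSl2 where
  lie_smul a x y := by
    ext1
    · simp only [loop_lie, loop_smul, coeffD_smul, lie_smul, map_smul, smul_add, smul_sub,
        mul_smul, smul_comm x.coeffD a]
    · simp
    · simp

/-- The element `x ⊗ t ^ n` of the affine Lie algebra. -/
def tpow (n : ℤ) (x : sl2) : AffineSl2 := ⟨loopPow n x, 0, 0⟩

theorem tpow_lie (m n : ℤ) (x y : sl2) :
    ⁅tpow m x, tpow n y⁆ =
      ⟨loopPow (m + n) ⁅x, y⁆, if m + n = 0 then (m : ℂ) * form x y else 0, 0⟩ := by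
  ext1 <;> simp [tpow, cocycle_loopPow]

/-- The canonical central element. -/
def c : AffineSl2 := ⟨0, 1, 0⟩

/-- The scaling element. -/
def d : AffineSl2 := ⟨0, 0, 1⟩

/-! ### The Cartan subalgebra, its dual and the Weyl group -/

/-- The Cartan subalgebra `𝔥 = ℂ α^∨ ⊕ ℂ c ⊕ ℂ d`, in coordinates with respect to `α^∨, c, d`. -/
abbrev Cartan : Type := ℂ × ℂ × ℂ

/-- The element of the affine Lie algebra with the given coordinates, `α^∨` being `h ⊗ 1`. -/
def ofCartan (x : Cartan) : AffineSl2 := x.1 • tpow 0 h + x.2.1 • c + x.2.2 • d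

/-- The dual `𝔥^*` of the Cartan subalgebra. -/
abbrev Weight : Type := Module.Dual ℂ Cartan

/-- `Λ₀` vanishes on `α^∨` and `d`, and is `1` on `c`. -/
def Lambda0 : Weight := LinearMap.fst ℂ ℂ ℂ ∘ₗ LinearMap.snd ℂ ℂ (ℂ × ℂ)

/-- The simple root `α` of `sl₂`: it vanishes on `c` and `d`, and is `2` on `α^∨`. -/
def alpha : Weight := (2 : ℂ) • LinearMap.fst ℂ ℂ (ℂ × ℂ)

/-- The imaginary root `δ` vanishes on `α^∨` and `c`, and is `1` on `d`. -/
def delta : Weight := LinearMap.snd ℂ ℂ ℂ ∘ₗ LinearMap.snd ℂ ℂ (ℂ × ℂ)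

/-- `ρ = 2 Λ₀ + α / 2`. -/
def rho : Weight := (2 : ℂ) • Lambda0 + (1 / 2 : ℂ) • alpha

/-- The projection `π : 𝔥^* = ℂ Λ₀ ⊕ ℂ α ⊕ ℂ δ → ℂ Λ₀ ⊕ ℂ α`. -/
def proj (mu : Weight) : Weight := mu (0, 1, 0) • Lambda0 + (mu (1, 0, 0) / 2) • alpha

/-- The simple roots `α_0 = δ - α`, `α_1 = α`. -/
def simpleRoot : Fin 2 → Weight := ![delta - alpha, alpha]

/-- The simple coroots `α_0^∨ = c - α^∨`, `α_1^∨ = α^∨`. -/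
def simpleCoroot : Fin 2 → Cartan := ![(-1, 1, 0), (1, 0, 0)]

theorem simpleRoot_simpleCoroot (i : Fin 2) :
    Module.Dual.eval ℂ Cartan (simpleCoroot i) (simpleRoot i) = 2 := by
  fin_cases i <;> simp [simpleRoot, simpleCoroot, alpha, delta]

/-- The simple reflection `s_i (μ) = μ - μ(α_i^∨) α_i` of `𝔥^*`. -/
def simpleReflection (i : Fin 2) : Weight ≃ₗ[ℂ] Weight :=
  Module.reflection (simpleRoot_simpleCoroot i)

/-- The affine Weyl group, acting on `𝔥^*`. -/
def weylGroup : Subgroup (Weight ≃ₗ[ℂ] Weight) :=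
  Subgroup.closure (Set.range simpleReflection)

/-- The length of `v`: the least length of a word in the simple reflections with product `v`. -/
def length (v : weylGroup) : ℕ :=
  sInf {n : ℕ | ∃ l : List (Fin 2), l.length = n ∧ (l.map simpleReflection).prod = v}

/-- The sign `ε(v) = (-1) ^ ℓ(v)`. -/
def sign (v : weylGroup) : ℤ := (-1) ^ length v

/-- The weight `m Λ₀ + (j / 2) α`. -/
def wt (m j : ℕ) : Weight := (m : ℂ) • Lambda0 + ((j : ℂ) / 2) • alpha

/-! ### Irreducible highest weight modules -/

section Modules

variable (V : Type*) [AddCommGroup V] [Module ℂ V] [LieRingModule AffineSl2 V]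
  [LieModule ℂ AffineSl2 V]

/-- `V` is the irreducible highest weight module `L(Λ)`: it is irreducible, and it has a nonzero
vector of weight `Λ` which is killed by `𝔫₊ = ℂ e ⊕ ⨁_{n > 0} sl₂ ⊗ t ^ n`. -/
structure IsIrreducibleHighestWeight (Lam : Weight) : Prop where
  irreducible : LieModule.IsIrreducible ℂ AffineSl2 V
  exists_vector : ∃ v : V, v ≠ 0 ∧ (∀ x : Cartan, ⁅ofCartan x, v⁆ = Lam x • v) ∧
    ⁅tpow 0 e, v⁆ = 0 ∧ ∀ n : ℤ, 0 < n → ∀ x : sl2, ⁅tpow n x, v⁆ = 0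

/-- The set `P(V)` of weights of `V`. -/
def weights : Set Weight :=
  {mu | ∃ v : V, v ≠ 0 ∧ ∀ x : Cartan, ⁅ofCartan x, v⁆ = mu x • v}

/-- The set `P^o(V)` of `δ`-maximal weights of `V`. -/
def maximalWeights : Set Weight :=
  {mu | mu ∈ weights V ∧ ∀ n : ℤ, 0 < n → mu + (n : ℂ) • delta ∉ weights V}

/-- The relation `λ + Λ'' + ρ = v (Λ + ρ) + S δ`, which says that `v = v_{Λ, Λ'', λ}` and
`S = S_{Λ, Λ'', λ}`. -/
def IsDecomposition (Lam Lam'' lam : Weight) (v : weylGroup) (S : ℤ) : Prop :=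
  lam + Lam'' + rho = (v : Weight ≃ₗ[ℂ] Weight) (Lam + rho) + (S : ℂ) • delta

/-- The set `T_Λ^{Λ', Λ''}`, where `V = L(Λ')`. -/
def tensorSet (Lam Lam'' : Weight) : Set Weight :=
  {lam | lam ∈ maximalWeights V ∧ ∃ (v : weylGroup) (S : ℤ), IsDecomposition Lam Lam'' lam v S}

end Modules

end AffineSl2

end

open scoped TensorProduct

noncomputable section

namespace AffineSl2

/-! ### Chevalley generators -/

/-! Write a weight of $L(\Lambda')$ as $\Lambda'+k\alpha-n\delta$. Since the weight set is
Weyl-stable and lies below $\Lambda'$, its translates bound $n$ below by the lines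
$(2p+\varepsilon)k+pj'-p(p+\varepsilon)m'$ with $p\in\mathbb Z$, $\varepsilon\in\{0,1\}$
(`le_of_mem_weights`). For every $k$ one of these bounds is attained, by a translate of a weight on
one of the two simple root strings through $\Lambda'$ (`exists_mem_weights`). So the
$\delta$-maximal weight over $k$ has $n=F(k)$, where $F$ is the maximum of these lines, a convex
piecewise linear function.

Even Weyl group elements are the translations $t_{s\alpha}$ (`isTranslation_of_sign`). For such an
element the decomposition forces $k=J+s(m+2)$ and $S=s(j+1)+s^2(m+2)-F(k)$, with $J=(j-j'-j'')/2$
(`isDecomposition_gridWeight`). The claim is therefore $F(J+s(m+2))-F(J)>s(j+1)+s^2(m+2)$ for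
$s\ne0$. As $F$ is a maximum of lines, it is enough to take the line active at $J$ and exhibit one
other line that is high enough at the shifted point (`exists_shift_lt`). Heuristically, $F$ grows
like $k^2/m'$, faster than the parabola of level $m+2$.

The representation theory needed is Weyl stability: Chevalley generators generate, singular vectors
bound weights, the lowering generators act locally nilpotently, and $\mathfrak{sl}_2$-strings give
the reflections. -/

theorem e_lie_f : ⁅e, f⁆ = h := by
  apply toMatrix_injective
  rw [toMatrix_lie]
  ext i j; fin_cases i <;> fin_cases j <;> simp

theorem h_lie_e : ⁅h, e⁆ = (2 : ℂ) • e := by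
  apply toMatrix_injective
  rw [toMatrix_lie, map_smul]
  ext i j; fin_cases i <;> fin_cases j <;> norm_num [Matrix.mul_apply, Fin.sum_univ_two]

theorem h_lie_f : ⁅h, f⁆ = (-2 : ℂ) • f := by
  apply toMatrix_injective
  rw [toMatrix_lie, map_smul]
  ext i j; fin_cases i <;> fin_cases j <;> norm_num [Matrix.mul_apply, Fin.sum_univ_two]

theorem f_lie_e : ⁅f, e⁆ = -h := by rw [← lie_skew, e_lie_f]

theorem e_lie_h : ⁅e, h⁆ = (-2 : ℂ) • e := by rw [← lie_skew, h_lie_e, neg_smul]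

theorem f_lie_h : ⁅f, h⁆ = (2 : ℂ) • f := by rw [← lie_skew, h_lie_f, neg_smul, neg_neg]

theorem sl2_eq (x : sl2) :
    x = toMatrix x 0 1 • e + toMatrix x 1 0 • f + toMatrix x 0 0 • h := by
  have ht : toMatrix x 0 0 + toMatrix x 1 1 = 0 := by
    have : Matrix.trace (toMatrix x) = 0 := x.2
    rwa [Matrix.trace_fin_two] at this
  apply toMatrix_injective
  simp only [map_add, map_smul, toMatrix_e, toMatrix_f, toMatrix_h]
  ext i j; fin_cases i <;> fin_cases j <;> simp
  linear_combination ht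

theorem loopPow_add (n : ℤ) (x y : sl2) : loopPow n (x + y) = loopPow n x + loopPow n y :=
  TensorProduct.tmul_add _ _ _

theorem loopPow_smul (n : ℤ) (a : ℂ) (x : sl2) : loopPow n (a • x) = a • loopPow n x :=
  TensorProduct.tmul_smul _ _ _

theorem tpow_add (n : ℤ) (x y : sl2) : tpow n (x + y) = tpow n x + tpow n y := by
  ext1 <;> simp [tpow, loopPow_add]

theorem tpow_smul (n : ℤ) (a : ℂ) (x : sl2) : tpow n (a • x) = a • tpow n x := by
  ext1 <;> simp [tpow, loopPow_smul]

theorem tpow_neg (n : ℤ) (x : sl2) : tpow n (-x) = -tpow n x := by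
  rw [← neg_one_smul ℂ x, tpow_smul, neg_one_smul]

theorem tpow_zero_right (n : ℤ) : tpow n 0 = 0 := by
  rw [← zero_smul ℂ (0 : sl2), tpow_smul, zero_smul]

/-- The generators `e_0 = f ⊗ t`, `e_1 = e`. -/
def raise : Fin 2 → AffineSl2 := ![tpow 1 f, tpow 0 e]

/-- The generators `f_0 = e ⊗ t⁻¹`, `f_1 = f`. -/
def lower : Fin 2 → AffineSl2 := ![tpow (-1) e, tpow 0 f]

theorem tpow_lie_of_ne {m n : ℤ} (hmn : m + n ≠ 0) (x y : sl2) :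
    ⁅tpow m x, tpow n y⁆ = tpow (m + n) ⁅x, y⁆ := by
  rw [tpow_lie, if_neg hmn]; rfl

theorem tpow_zero_lie (n : ℤ) (x y : sl2) : ⁅tpow 0 x, tpow n y⁆ = tpow n ⁅x, y⁆ := by
  rw [tpow_lie, zero_add]; simp [tpow]

theorem lie_tpow_zero (n : ℤ) (x y : sl2) : ⁅tpow n x, tpow 0 y⁆ = tpow n ⁅x, y⁆ := by
  rw [← lie_skew, tpow_zero_lie, ← lie_skew x y, tpow_neg]

theorem ofCartan_lie_tpow (x : Cartan) (n : ℤ) (y : sl2) :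
    ⁅ofCartan x, tpow n y⁆ = x.1 • tpow n ⁅h, y⁆ + (x.2.2 * n) • tpow n y := by
  simp only [ofCartan, add_lie, smul_lie, tpow_zero_lie]
  ext1 <;> simp [tpow, c, d, mul_smul]

theorem ofCartan_lie_ofCartan (x y : Cartan) : ⁅ofCartan x, ofCartan y⁆ = 0 := by
  ext1 <;> simp [ofCartan, tpow, c, d]

theorem ofCartan_lie_raise (x : Cartan) (i : Fin 2) :
    ⁅ofCartan x, raise i⁆ = simpleRoot i x • raise i := by
  fin_cases i
  · simp only [raise, ofCartan_lie_tpow, h_lie_f, tpow_smul, simpleRoot, delta, alpha, smul_smul,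
      ← add_smul, Fin.zero_eta, Matrix.cons_val_zero]
    congr 1
    simp
    ring
  · simp only [raise, ofCartan_lie_tpow, h_lie_e, tpow_smul, simpleRoot, alpha, smul_smul,
      ← add_smul, Fin.mk_one, Matrix.cons_val_one, Matrix.cons_val_zero]
    congr 1
    simp
    ring

theorem ofCartan_lie_lower (x : Cartan) (i : Fin 2) :
    ⁅ofCartan x, lower i⁆ = -(simpleRoot i x • lower i) := by
  fin_cases i
  · simp only [lower, ofCartan_lie_tpow, h_lie_e, tpow_smul, simpleRoot, delta, alpha, smul_smul,
      ← add_smul, ← neg_smul, Fin.zero_eta, Matrix.cons_val_zero]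
    congr 1
    simp
    ring
  · simp only [lower, ofCartan_lie_tpow, h_lie_f, tpow_smul, simpleRoot, alpha, smul_smul,
      ← add_smul, ← neg_smul, Fin.mk_one, Matrix.cons_val_one, Matrix.cons_val_zero]
    congr 1
    simp
    ring

theorem form_f_e : form f e = 1 := by
  simp [form_apply, Matrix.trace_fin_two]

theorem raise_lie_lower_self (i : Fin 2) :
    ⁅raise i, lower i⁆ = ofCartan (simpleCoroot i) := by
  fin_cases i
  · change ⁅tpow 1 f, tpow (-1) e⁆ = ofCartan (-1, 1, 0)
    rw [tpow_lie, f_lie_e, form_f_e, ← neg_one_smul ℂ h, loopPow_smul]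
    ext1 <;> simp [ofCartan, tpow, c, d]
  · simp [raise, lower, tpow_zero_lie, simpleCoroot, ofCartan, e_lie_f]

theorem raise_lie_lower_of_ne {i j : Fin 2} (hij : i ≠ j) : ⁅raise i, lower j⁆ = 0 := by
  fin_cases i <;> fin_cases j
  · exact absurd rfl hij
  · change ⁅tpow 1 f, tpow 0 f⁆ = 0
    rw [lie_tpow_zero, lie_self, tpow_zero_right]
  · change ⁅tpow 0 e, tpow (-1) e⁆ = 0
    rw [tpow_zero_lie, lie_self, tpow_zero_right]
  · exact absurd rfl hij

theorem isSl2Triple (i : Fin 2) :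
    IsSl2Triple (ofCartan (simpleCoroot i)) (raise i) (lower i) where
  h_ne_zero h0 := by
    have h1 := ofCartan_lie_raise (simpleCoroot i) i
    have h2 : simpleRoot i (simpleCoroot i) = 2 := simpleRoot_simpleCoroot i
    -- If the coroot vanished, the relation $[h_i,e_i]=2e_i$ would kill $e_i$, whose loop component
    -- is visibly nonzero.
    rw [h0, zero_lie, h2, eq_comm, smul_eq_zero] at h1
    have h3 := h1.resolve_left two_ne_zero
    have h4 : (0 : AffineSl2).loop = 0 := rfl
    rw [← h3] at h4
    have key : ∀ (n : ℤ) (x : sl2), loopPow n x = 0 → x = 0 := fun n x hx => by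
      have := congrArg toFinsupp hx
      simpa using this
    fin_cases i
    · have := congrArg (fun x => toMatrix x 1 0) (key _ _ h4)
      simp at this
    · have := congrArg (fun x => toMatrix x 0 1) (key _ _ h4)
      simp at this
  lie_e_f := raise_lie_lower_self i
  lie_h_e_nsmul := by
    have h2 : simpleRoot i (simpleCoroot i) = 2 := simpleRoot_simpleCoroot i
    rw [ofCartan_lie_raise, h2, two_smul, two_nsmul]
  lie_h_f_nsmul := by
    have h2 : simpleRoot i (simpleCoroot i) = 2 := simpleRoot_simpleCoroot i
    rw [ofCartan_lie_lower, h2, two_smul, two_nsmul]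

/-- The Serre relations: the off-diagonal Cartan integers are $-2$, so exponent $3$ suffices. This
makes `lower i` ad-nilpotent on the generators. -/
theorem lower_lie_lower_cube (i j : Fin 2) :
    ⁅lower i, ⁅lower i, ⁅lower i, lower j⁆⁆⁆ = 0 := by
  have h0 : lower 0 = tpow (-1) e := rfl
  have h1 : lower 1 = tpow 0 f := rfl
  fin_cases i <;> fin_cases j <;> simp only [Fin.zero_eta, Fin.mk_one, h0, h1]
  · rw [lie_self, lie_zero, lie_zero]
  · rw [lie_tpow_zero, e_lie_f, tpow_lie_of_ne (m := -1) (n := -1) (by decide), e_lie_h,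
      tpow_smul, lie_smul, tpow_lie_of_ne (m := -1) (n := -1 + -1) (by decide), lie_self,
      tpow_zero_right, smul_zero]
  · rw [tpow_zero_lie, f_lie_e, tpow_zero_lie, lie_neg f h, f_lie_h, tpow_zero_lie,
      lie_neg f (_ • f), lie_smul _ f f, lie_self f, smul_zero, neg_zero, tpow_zero_right]
  · rw [lie_self, lie_zero, lie_zero]

/-- A Lie subalgebra containing the Cartan subalgebra and the Chevalley generators is
everything. -/
theorem eq_top_of_generators (K : LieSubalgebra ℂ AffineSl2) (hC : ∀ x, ofCartan x ∈ K)
    (hr : ∀ i, raise i ∈ K) (hl : ∀ i, lower i ∈ K) (x : AffineSl2) : x ∈ K := by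
  have he : tpow 0 e ∈ K := hr 1
  have hf : tpow 0 f ∈ K := hl 1
  have hf1 : tpow 1 f ∈ K := hr 0
  have he1 : tpow (-1) e ∈ K := hl 0
  have hc : c ∈ K := by simpa [ofCartan] using hC (0, 1, 0)
  have hd : d ∈ K := by simpa [ofCartan] using hC (0, 0, 1)
  have hh : tpow 0 h ∈ K := by simpa [ofCartan] using hC (1, 0, 0)
  have smul_mem : ∀ (n : ℤ) (a : ℂ) (y : sl2), a ≠ 0 → tpow n (a • y) ∈ K → tpow n y ∈ K := by
    intro n a y ha hy
    have := K.smul_mem a⁻¹ hy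
    rwa [← tpow_smul, smul_smul, inv_mul_cancel₀ ha, one_smul] at this
  have of_f : ∀ n, tpow n f ∈ K → tpow n h ∈ K ∧ tpow n e ∈ K := by
    intro n hn
    have h1 := K.lie_mem he hn
    rw [tpow_zero_lie, e_lie_f] at h1
    refine ⟨h1, ?_⟩
    have h2 := K.lie_mem he h1
    rw [tpow_zero_lie, e_lie_h] at h2
    exact smul_mem _ _ _ (by norm_num) h2
  have of_e : ∀ n, tpow n e ∈ K → tpow n h ∈ K ∧ tpow n f ∈ K := by
    intro n hn
    have h1 := K.lie_mem hn hf
    rw [lie_tpow_zero, e_lie_f] at h1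
    refine ⟨h1, ?_⟩
    have h2 := K.lie_mem hf h1
    rw [tpow_zero_lie, f_lie_h] at h2
    exact smul_mem _ _ _ (by norm_num) h2
  -- Climb one loop degree at a time by $[f\otimes t,h\otimes t^n]=2f\otimes t^{n+1}$. The total
  -- degree is nonzero, so no central term appears; negative degrees use $e\otimes t^{-1}$ in the
  -- same way.
  have hpos : ∀ n : ℕ, tpow (n : ℤ) f ∈ K := by
    intro n
    induction n with
    | zero => exact hf
    | succ n ih =>
      have h1 := K.lie_mem hf1 (of_f _ ih).1
      rw [tpow_lie_of_ne (by omega), f_lie_h] at h1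
      have := smul_mem _ _ _ (by norm_num) h1
      rwa [add_comm] at this
  have hneg : ∀ n : ℕ, tpow (-(n : ℤ)) e ∈ K := by
    intro n
    induction n with
    | zero => exact he
    | succ n ih =>
      have h1 := K.lie_mem he1 (of_e _ ih).1
      rw [tpow_lie_of_ne (by omega), e_lie_h] at h1
      have := smul_mem _ _ _ (by norm_num) h1
      rwa [show -1 + -(n : ℤ) = -((n + 1 : ℕ) : ℤ) by push_cast; ring] at this
  have hall : ∀ (n : ℤ) (y : sl2), tpow n y ∈ K := by
    intro n y
    have : tpow n e ∈ K ∧ tpow n f ∈ K ∧ tpow n h ∈ K := by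
      obtain ⟨k, rfl | rfl⟩ := n.eq_nat_or_neg
      · exact ⟨(of_f _ (hpos k)).2, hpos k, (of_f _ (hpos k)).1⟩
      · exact ⟨hneg k, (of_e _ (hneg k)).2, (of_e _ (hneg k)).1⟩
    rw [sl2_eq y, tpow_add, tpow_add, tpow_smul, tpow_smul, tpow_smul]
    exact K.add_mem (K.add_mem (K.smul_mem _ this.1) (K.smul_mem _ this.2.1))
      (K.smul_mem _ this.2.2)
  have hloop : ∀ g : Loop, (⟨g, 0, 0⟩ : AffineSl2) ∈ K := by
    intro g
    induction g using loop_induction with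
    | h0 => exact K.zero_mem
    | h1 n x => exact hall n x
    | h2 a b ha hb =>
      have := K.add_mem ha hb
      convert this using 1
      ext1 <;> simp
  have hx : x = (⟨x.loop, 0, 0⟩ : AffineSl2) + (x.coeffC • c + x.coeffD • d) := by
    ext1 <;> simp [c, d]
  rw [hx]
  exact K.add_mem (hloop _) (K.add_mem (K.smul_mem _ hc) (K.smul_mem _ hd))

/-! ### Weight vectors and singular vectors -/

section Modules

variable {V : Type*} [AddCommGroup V] [Module ℂ V] [LieRingModule AffineSl2 V]
  [LieModule ℂ AffineSl2 V]

variable (V) in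
/-- The weight space of weight `mu`. -/
def weightSpace (mu : Weight) : Submodule ℂ V where
  carrier := {v | ∀ x : Cartan, ⁅ofCartan x, v⁆ = mu x • v}
  zero_mem' x := by simp
  add_mem' hv hw x := by rw [lie_add, hv x, hw x, smul_add]
  smul_mem' a v hv x := by rw [lie_smul, hv x, smul_comm]

theorem weightSpace_congr {mu nu : Weight} {v : V} (hv : v ∈ weightSpace V mu) (h : mu = nu) :
    v ∈ weightSpace V nu := h ▸ hv

theorem raise_mem_weightSpace {mu : Weight} {v : V} (hv : v ∈ weightSpace V mu) (i : Fin 2) :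
    ⁅raise i, v⁆ ∈ weightSpace V (mu + simpleRoot i) := fun x => by
  rw [leibniz_lie, ofCartan_lie_raise, hv x, lie_smul, smul_lie, LinearMap.add_apply, add_smul,
    add_comm]

theorem lower_mem_weightSpace {mu : Weight} {v : V} (hv : v ∈ weightSpace V mu) (i : Fin 2) :
    ⁅lower i, v⁆ ∈ weightSpace V (mu - simpleRoot i) := fun x => by
  rw [leibniz_lie, ofCartan_lie_lower, hv x, lie_smul, neg_lie, smul_lie, LinearMap.sub_apply,
    sub_smul]
  abel

theorem raise_pow_mem_weightSpace {mu : Weight} {v : V} (hv : v ∈ weightSpace V mu) (i : Fin 2)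
    (n : ℕ) : (LieModule.toEnd ℂ AffineSl2 V (raise i) ^ n) v ∈
      weightSpace V (mu + (n : ℂ) • simpleRoot i) := by
  induction n with
  | zero => simpa using hv
  | succ n ih =>
    rw [pow_succ', Module.End.mul_apply]
    refine weightSpace_congr (raise_mem_weightSpace ih i) ?_
    push_cast; module

theorem lower_pow_mem_weightSpace {mu : Weight} {v : V} (hv : v ∈ weightSpace V mu) (i : Fin 2)
    (n : ℕ) : (LieModule.toEnd ℂ AffineSl2 V (lower i) ^ n) v ∈
      weightSpace V (mu - (n : ℂ) • simpleRoot i) := by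
  induction n with
  | zero => simpa using hv
  | succ n ih =>
    rw [pow_succ', Module.End.mul_apply]
    refine weightSpace_congr (lower_mem_weightSpace ih i) ?_
    push_cast; module

variable (V) in
-- The Cartan subalgebra acts by commuting operators, so simultaneous generalized eigenspaces are
-- independent, and weight spaces sit inside them.
theorem iSupIndep_weightSpace : iSupIndep (weightSpace V) := by
  have hcomm : ∀ (x y : Cartan) (a : ℂ),
      Set.MapsTo (LieModule.toEnd ℂ AffineSl2 V (ofCartan x))
        ((LieModule.toEnd ℂ AffineSl2 V (ofCartan y)).maxGenEigenspace a)
        ((LieModule.toEnd ℂ AffineSl2 V (ofCartan y)).maxGenEigenspace a) := by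
    intro x y a
    apply Module.End.mapsTo_maxGenEigenspace_of_comm
    ext v
    have h := lie_lie (ofCartan y) (ofCartan x) v
    rw [ofCartan_lie_ofCartan, zero_lie, eq_comm, sub_eq_zero] at h
    exact h
  have h1 := Module.End.independent_iInf_maxGenEigenspace_of_forall_mapsTo
    (fun x : Cartan => LieModule.toEnd ℂ AffineSl2 V (ofCartan x)) hcomm
  have h2 : Function.Injective (fun mu : Weight => (fun x => mu x : Cartan → ℂ)) :=
    fun mu nu h => LinearMap.ext fun x => congrFun h x
  refine (h1.comp h2).mono fun mu v hv => ?_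
  simp only [Function.comp, Submodule.mem_iInf]
  intro x
  refine Module.End.genEigenspace_le_maximal _ _ 1 ?_
  exact Module.End.mem_eigenspace_iff.2 (hv x)

/-- The elements of the Lie algebra which map a given subspace to itself. -/
def stabilizer (U : Submodule ℂ V) : LieSubalgebra ℂ AffineSl2 where
  carrier := {x | ∀ v ∈ U, ⁅x, v⁆ ∈ U}
  zero_mem' v _ := by rw [zero_lie]; exact U.zero_mem
  add_mem' hx hy v hv := by rw [add_lie]; exact U.add_mem (hx v hv) (hy v hv)
  smul_mem' a x hx v hv := by rw [smul_lie]; exact U.smul_mem a (hx v hv)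
  lie_mem' hx hy v hv := by
    rw [lie_lie]; exact U.sub_mem (hx _ (hy v hv)) (hy _ (hx v hv))

theorem eq_top_of_stable (hV : LieModule.IsIrreducible ℂ AffineSl2 V) {U : Submodule ℂ V}
    (hU : U ≠ ⊥) (hC : ∀ x, ofCartan x ∈ stabilizer U) (hr : ∀ i, raise i ∈ stabilizer U)
    (hl : ∀ i, lower i ∈ stabilizer U) : U = ⊤ := by
  let N : LieSubmodule ℂ AffineSl2 V :=
    { U with lie_mem := fun {x v} hv => eq_top_of_generators (stabilizer U) hC hr hl x v hv }
  have hN : N = ⊤ := by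
    refine (eq_bot_or_eq_top N).resolve_left fun h => hU ?_
    exact (congrArg LieSubmodule.toSubmodule h).trans LieSubmodule.bot_toSubmodule
  exact (congrArg LieSubmodule.toSubmodule hN).trans LieSubmodule.top_toSubmodule

/-- A vector of weight `mu` killed by the raising generators. -/
structure IsSingular (mu : Weight) (u : V) : Prop where
  mem_weightSpace : u ∈ weightSpace V mu
  raise : ∀ i, ⁅raise i, u⁆ = 0

/-- The result of applying a word in the lowering generators. -/
def lowerWord (u : V) : List (Fin 2) → V
  | [] => u
  | i :: l => ⁅lower i, lowerWord u l⁆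

theorem lowerWord_mem_weightSpace {mu : Weight} {u : V} (hu : u ∈ weightSpace V mu)
    (l : List (Fin 2)) : ∃ a b : ℕ,
      lowerWord u l ∈ weightSpace V (mu - (a : ℂ) • simpleRoot 0 - (b : ℂ) • simpleRoot 1) := by
  induction l with
  | nil => exact ⟨0, 0, by simpa [lowerWord] using hu⟩
  | cons i l ih =>
    obtain ⟨a, b, hab⟩ := ih
    have h := lower_mem_weightSpace hab i
    fin_cases i
    · refine ⟨a + 1, b, ?_⟩
      refine weightSpace_congr h ?_
      simp only [Fin.zero_eta]; push_cast; module
    · refine ⟨a, b + 1, ?_⟩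
      refine weightSpace_congr h ?_
      simp only [Fin.mk_one]; push_cast; module

/-- The span of all words in the lowering generators applied to a vector. -/
def lowerSpan (u : V) : Submodule ℂ V := Submodule.span ℂ (Set.range (lowerWord u))

theorem mem_stabilizer_lowerSpan {u : V} {x : AffineSl2}
    (hx : ∀ l, ⁅x, lowerWord u l⁆ ∈ lowerSpan u) : x ∈ stabilizer (lowerSpan u) := by
  intro v hv
  induction hv using Submodule.span_induction with
  | mem v hv => obtain ⟨l, rfl⟩ := hv; exact hx l
  | zero => rw [lie_zero]; exact zero_mem _
  | add v w _ _ ih ih' => rw [lie_add]; exact add_mem ih ih'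
  | smul a v _ ih => rw [lie_smul]; exact Submodule.smul_mem _ _ ih

omit [LieModule ℂ AffineSl2 V] in
theorem lowerWord_mem (u : V) (l : List (Fin 2)) : lowerWord u l ∈ lowerSpan u :=
  Submodule.subset_span ⟨l, rfl⟩

theorem lower_mem_stabilizer (u : V) (i : Fin 2) : lower i ∈ stabilizer (lowerSpan u) :=
  mem_stabilizer_lowerSpan fun l => lowerWord_mem u (i :: l)

theorem ofCartan_mem_stabilizer {mu : Weight} {u : V} (hu : u ∈ weightSpace V mu) (x : Cartan) :
    ofCartan x ∈ stabilizer (lowerSpan u) :=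
  mem_stabilizer_lowerSpan fun l => by
    obtain ⟨a, b, h⟩ := lowerWord_mem_weightSpace hu l
    rw [h x]
    exact Submodule.smul_mem _ _ (lowerWord_mem u l)

/-- Induction on the word: moving $e_i$ past $f_j$ costs only $[e_i,f_j]$, which is zero or a Cartan
element acting on the rest of the word by a scalar. -/
theorem raise_mem_stabilizer {mu : Weight} {u : V} (hu : IsSingular mu u) (i : Fin 2) :
    raise i ∈ stabilizer (lowerSpan u) :=
  mem_stabilizer_lowerSpan fun l => by
    induction l with
    | nil => rw [lowerWord, hu.raise]; exact zero_mem _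
    | cons j l ih =>
      rw [lowerWord, leibniz_lie]
      refine add_mem ?_ (lower_mem_stabilizer u j _ ih)
      by_cases hij : i = j
      · subst hij
        rw [raise_lie_lower_self]
        exact ofCartan_mem_stabilizer hu.mem_weightSpace _ _ (lowerWord_mem u l)
      · rw [raise_lie_lower_of_ne hij, zero_lie]
        exact zero_mem _

/-- The weights of an irreducible module with a singular vector of weight `mu` are bounded
by `mu`. -/
theorem weights_le_of_isSingular (hV : LieModule.IsIrreducible ℂ AffineSl2 V) {mu : Weight}
    {u : V} (hu0 : u ≠ 0) (hu : IsSingular mu u) {nu : Weight} (hnu : nu ∈ weights V) :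
    ∃ a b : ℕ, nu = mu - (a : ℂ) • simpleRoot 0 - (b : ℂ) • simpleRoot 1 := by
  have htop : lowerSpan u = ⊤ :=
    eq_top_of_stable hV
      (fun h => hu0 (by
        have := lowerWord_mem u []
        rwa [h, Submodule.mem_bot] at this))
      (ofCartan_mem_stabilizer hu.mem_weightSpace) (raise_mem_stabilizer hu)
      (lower_mem_stabilizer u)
  let s : Set Weight :=
    {nu | ∃ a b : ℕ, nu = mu - (a : ℂ) • simpleRoot 0 - (b : ℂ) • simpleRoot 1}
  have hle : lowerSpan u ≤ ⨆ nu ∈ s, weightSpace V nu := by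
    refine Submodule.span_le.2 ?_
    rintro _ ⟨l, rfl⟩
    obtain ⟨a, b, h⟩ := lowerWord_mem_weightSpace hu.mem_weightSpace l
    exact Submodule.mem_iSup_of_mem _ (Submodule.mem_iSup_of_mem ⟨a, b, rfl⟩ h)
  rw [htop, top_le_iff] at hle
  -- The weight spaces indexed by `s` already fill $V$, so by independence no other weight space is
  -- nonzero.
  refine (iSupIndep_weightSpace V).mem_of_biSup_eq_top hle fun h => ?_
  obtain ⟨v, hv0, hv⟩ := hnu
  have : v ∈ weightSpace V nu := hv
  rw [h] at this
  exact hv0 this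

/-! ### Integrability -/

/-- The vectors killed by a power of `y`. -/
def nilSpace (y : AffineSl2) : Submodule ℂ V where
  carrier := {v | ∃ n : ℕ, (LieModule.toEnd ℂ AffineSl2 V y ^ n) v = 0}
  zero_mem' := ⟨0, map_zero _⟩
  add_mem' := by
    rintro v w ⟨m, hm⟩ ⟨n, hn⟩
    refine ⟨m + n, ?_⟩
    rw [map_add, pow_add, Module.End.mul_apply, Module.End.mul_apply, hn, map_zero, add_zero,
      ← Module.End.mul_apply, ← pow_add, add_comm, pow_add, Module.End.mul_apply, hm, map_zero]
  smul_mem' := by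
    rintro a v ⟨n, hn⟩
    exact ⟨n, by rw [map_smul, hn, smul_zero]⟩

theorem lie_mem_nilSpace_iff {y : AffineSl2} {v : V} :
    ⁅y, v⁆ ∈ nilSpace y ↔ v ∈ nilSpace y := by
  constructor
  · rintro ⟨n, hn⟩
    exact ⟨n + 1, by rwa [pow_succ, Module.End.mul_apply]⟩
  · rintro ⟨n, hn⟩
    refine ⟨n, ?_⟩
    rw [← LieModule.toEnd_apply_apply ℂ, ← Module.End.mul_apply, ← pow_succ, pow_succ',
      Module.End.mul_apply, hn, map_zero]

/-- From $yxv=[y,x]v+xyv$, by induction on the power of $y$ killing $v$. Iterating, every $x$ killed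
by a power of $\mathrm{ad}\,y$ preserves `nilSpace y`. -/
theorem mem_stabilizer_nilSpace {x y : AffineSl2}
    (hx : ⁅y, x⁆ ∈ stabilizer (nilSpace (V := V) y)) : x ∈ stabilizer (nilSpace (V := V) y) := by
  rintro v ⟨n, hn⟩
  induction n generalizing v with
  | zero =>
    rw [pow_zero, Module.End.one_apply] at hn
    rw [hn, lie_zero]
    exact zero_mem _
  | succ n ih =>
    rw [← lie_mem_nilSpace_iff, leibniz_lie]
    refine add_mem (hx v ⟨n + 1, hn⟩) (ih _ ?_)
    rwa [pow_succ, Module.End.mul_apply] at hn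

/-- All generators are ad-nilpotent for `lower i`, so the locally nilpotent vectors form a
submodule; irreducibility spreads nilpotence from one nonzero vector to all. -/
theorem lower_nilSpace_eq_top (hV : LieModule.IsIrreducible ℂ AffineSl2 V) (i : Fin 2) {v : V}
    (hv : v ≠ 0) (hv' : v ∈ nilSpace (lower i)) : nilSpace (V := V) (lower i) = ⊤ := by
  have hl : lower i ∈ stabilizer (nilSpace (V := V) (lower i)) :=
    fun w hw => lie_mem_nilSpace_iff.2 hw
  have hC : ∀ x, ofCartan x ∈ stabilizer (nilSpace (V := V) (lower i)) := fun x => by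
    apply mem_stabilizer_nilSpace
    rw [← lie_skew, ofCartan_lie_lower, neg_neg]
    exact LieSubalgebra.smul_mem _ _ hl
  refine eq_top_of_stable hV (fun h => hv ?_) hC (fun j => ?_) (fun j => ?_)
  · rwa [h] at hv'
  · apply mem_stabilizer_nilSpace
    rw [← lie_skew]
    by_cases hij : j = i
    · subst hij
      rw [raise_lie_lower_self]
      exact neg_mem (hC _)
    · rw [raise_lie_lower_of_ne hij, neg_zero]
      exact zero_mem _
  · apply mem_stabilizer_nilSpace
    apply mem_stabilizer_nilSpace
    apply mem_stabilizer_nilSpace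
    rw [lower_lie_lower_cube]
    exact zero_mem _

/-- The coefficient in $ef^{k+1}v=(k+1)(n-k)f^kv$ is nonzero for $k<n$. -/
theorem pow_ne_zero_of_le {h e f : AffineSl2} {t : IsSl2Triple h e f} {v : V} {n : ℕ}
    (P : t.HasPrimitiveVectorWith v (n : ℂ)) {k : ℕ} (hk : k ≤ n) :
    (LieModule.toEnd ℂ AffineSl2 V f ^ k) v ≠ 0 := by
  induction k with
  | zero => simpa using P.ne_zero
  | succ k ih =>
    intro h0
    have h1 := P.lie_e_pow_succ_toEnd_f k
    rw [h0, lie_zero, eq_comm, smul_eq_zero] at h1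
    rcases h1 with h1 | h1
    · have h2 : (n : ℂ) - k ≠ 0 := by
        rw [sub_ne_zero]; exact_mod_cast (by omega : n ≠ k)
      exact mul_ne_zero (Nat.cast_add_one_ne_zero k) h2 h1
    · exact ih (by omega) h1

/-- If `v` is a vector of weight `n ≥ 0` for an `sl₂`-triple, killed by a power of `e`, then some
vector `f ^ (n + r) e ^ r v` does not vanish. -/
theorem exists_pow_pow_ne_zero {h e f : AffineSl2} (t : IsSl2Triple h e f) {v : V} (hv : v ≠ 0)
    {n : ℕ} (hh : ⁅h, v⁆ = (n : ℂ) • v) (he : v ∈ nilSpace e) :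
    ∃ r : ℕ, (LieModule.toEnd ℂ AffineSl2 V f ^ (n + r))
      ((LieModule.toEnd ℂ AffineSl2 V e ^ r) v) ≠ 0 := by
  obtain ⟨r, hr, hr'⟩ := Nat.exists_not_and_succ_of_not_zero_of_exists
    (p := fun k => (LieModule.toEnd ℂ AffineSl2 V e ^ k) v = 0) (by simpa using hv) he
  have hw : ∀ k : ℕ, ⁅h, (LieModule.toEnd ℂ AffineSl2 V e ^ k) v⁆ =
      ((n + 2 * k : ℕ) : ℂ) • (LieModule.toEnd ℂ AffineSl2 V e ^ k) v := by
    intro k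
    induction k with
    | zero => simpa using hh
    | succ k ih =>
      rw [pow_succ', Module.End.mul_apply, LieModule.toEnd_apply_apply, leibniz_lie,
        t.lie_h_e_smul ℂ, ih, lie_smul, smul_lie, ← add_smul]
      congr 1
      push_cast; ring
  have P : t.HasPrimitiveVectorWith ((LieModule.toEnd ℂ AffineSl2 V e ^ r) v)
      ((n + 2 * r : ℕ) : ℂ) :=
    ⟨hr, hw r, by rw [← LieModule.toEnd_apply_apply ℂ, ← Module.End.mul_apply, ← pow_succ', hr']⟩
  -- With $r$ the last exponent for which $e^rv\ne0$, the vector $e^rv$ is primitive of weight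
  -- $n+2r$, and $n+r\le n+2r$.
  exact ⟨r, pow_ne_zero_of_le P (by omega)⟩

/-- If `lower i` acts locally nilpotently and the `simpleRoot i`-string through the weight `mu` is
bounded above, then `s_i mu` is a weight. -/
theorem reflection_mem_weights (i : Fin 2) (hl : nilSpace (V := V) (lower i) = ⊤)
    {mu : Weight} (hmu : mu ∈ weights V)
    (hr : ∃ n : ℕ, mu + (n : ℂ) • simpleRoot i ∉ weights V) {p : ℤ}
    (hp : mu (simpleCoroot i) = p) : simpleReflection i mu ∈ weights V := by
  have hs : simpleReflection i mu = mu - (p : ℂ) • simpleRoot i := by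
    rw [← hp]; rfl
  rw [hs]
  obtain ⟨v, hv0, hv⟩ := hmu
  obtain ⟨n, rfl | rfl⟩ := p.eq_nat_or_neg
  · obtain ⟨r, h⟩ := exists_pow_pow_ne_zero (isSl2Triple i) hv0 (n := n)
      (by rw [hv, hp]; simp) (by
        obtain ⟨r, hr⟩ := hr
        by_contra h
        exact hr ⟨_, fun h0 => h ⟨r, h0⟩, raise_pow_mem_weightSpace hv i r⟩)
    refine ⟨_, h, ?_⟩
    refine weightSpace_congr
      (lower_pow_mem_weightSpace (raise_pow_mem_weightSpace hv i r) i (n + r)) ?_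
    push_cast; module
  -- For $p=-n$ the roles of $e$ and $f$ are exchanged; the nilpotence needed is now that of `lower
  -- i`.
  · obtain ⟨r, h⟩ := exists_pow_pow_ne_zero (isSl2Triple i).symm hv0 (n := n)
      (by rw [neg_lie, hv, hp]; simp) (by rw [hl]; trivial)
    refine ⟨_, h, ?_⟩
    refine weightSpace_congr
      (raise_pow_mem_weightSpace (lower_pow_mem_weightSpace hv i r) i (n + r)) ?_
    push_cast; module

end Modules

/-! ### The weights of the irreducible modules of dominant integral highest weight -/

/-- The weight `wt m j + k α - n δ`. -/
def gridWeight (m j : ℕ) (k n : ℤ) : Weight :=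
  wt m j + (k : ℂ) • alpha - (n : ℂ) • delta

theorem gridWeight_injective {m j : ℕ} {k k' n n' : ℤ}
    (h : gridWeight m j k n = gridWeight m j k' n') : k = k' ∧ n = n' := by
  have h1 := LinearMap.congr_fun h (1, 0, 0)
  have h2 := LinearMap.congr_fun h (0, 0, 1)
  simp [gridWeight, wt, Lambda0, alpha, delta] at h1 h2
  exact ⟨h1, h2⟩

theorem wt_apply (m j : ℕ) (x : Cartan) : wt m j x = m * x.2.1 + j * x.1 := by
  simp [wt, Lambda0, alpha]; ring

theorem gridWeight_apply (m j : ℕ) (k n : ℤ) (x : Cartan) :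
    gridWeight m j k n x = m * x.2.1 + (j + 2 * k) * x.1 - n * x.2.2 := by
  simp [gridWeight, wt_apply, alpha, delta]; ring

theorem simpleReflection_apply (i : Fin 2) (mu : Weight) :
    simpleReflection i mu = mu - mu (simpleCoroot i) • simpleRoot i := rfl

theorem simpleReflection_zero_gridWeight (m j : ℕ) (k n : ℤ) :
    simpleReflection 0 (gridWeight m j k n) =
      gridWeight m j (m - j - k) (n + (m - j - 2 * k)) := by
  rw [simpleReflection_apply, gridWeight_apply]
  simp only [gridWeight, simpleCoroot, simpleRoot, Matrix.cons_val_zero]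
  push_cast; module

theorem simpleReflection_one_gridWeight (m j : ℕ) (k n : ℤ) :
    simpleReflection 1 (gridWeight m j k n) = gridWeight m j (-k - j) n := by
  rw [simpleReflection_apply, gridWeight_apply]
  simp only [gridWeight, simpleCoroot, simpleRoot, Matrix.cons_val_one, Matrix.cons_val_zero]
  push_cast; module

section Modules

variable {V : Type*} [AddCommGroup V] [Module ℂ V] [LieRingModule AffineSl2 V]
  [LieModule ℂ AffineSl2 V] {m j : ℕ}

namespace IsIrreducibleHighestWeight

theorem exists_isSingular {Lam : Weight} (hV : IsIrreducibleHighestWeight V Lam) :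
    ∃ v : V, v ≠ 0 ∧ IsSingular Lam v := by
  obtain ⟨v, hv0, hv, he, hn⟩ := hV.exists_vector
  refine ⟨v, hv0, hv, fun i => ?_⟩
  fin_cases i
  · exact hn 1 one_pos f
  · exact he

theorem exists_gridWeight (hV : IsIrreducibleHighestWeight V (wt m j)) {mu : Weight}
    (hmu : mu ∈ weights V) : ∃ k n : ℤ, 0 ≤ n ∧ k ≤ n ∧ mu = gridWeight m j k n := by
  obtain ⟨v, hv0, hv⟩ := hV.exists_isSingular
  obtain ⟨a, b, rfl⟩ := weights_le_of_isSingular hV.irreducible hv0 hv hmu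
  refine ⟨a - b, a, by omega, by omega, ?_⟩
  simp only [gridWeight, simpleRoot, Matrix.cons_val_one, Matrix.cons_val_zero]
  push_cast; module

theorem nonneg_of_mem_weights (hV : IsIrreducibleHighestWeight V (wt m j)) {k n : ℤ}
    (h : gridWeight m j k n ∈ weights V) : 0 ≤ n ∧ k ≤ n := by
  obtain ⟨k', n', h1, h2, h3⟩ := hV.exists_gridWeight h
  obtain ⟨rfl, rfl⟩ := gridWeight_injective h3
  exact ⟨h1, h2⟩

theorem exists_add_notMem_weights (hV : IsIrreducibleHighestWeight V (wt m j)) (k n : ℤ)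
    (i : Fin 2) : ∃ r : ℕ, gridWeight m j k n + (r : ℂ) • simpleRoot i ∉ weights V := by
  fin_cases i
  · refine ⟨n.toNat + 1, fun h => ?_⟩
    have h1 : gridWeight m j k n + ((n.toNat + 1 : ℕ) : ℂ) • simpleRoot 0 =
        gridWeight m j (k - (n.toNat + 1 : ℕ)) (n - (n.toNat + 1 : ℕ)) := by
      simp only [gridWeight, simpleRoot, Matrix.cons_val_zero]
      push_cast; module
    have := hV.nonneg_of_mem_weights (h1 ▸ h)
    omega
  · refine ⟨(n - k).toNat + 1, fun h => ?_⟩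
    have h1 : gridWeight m j k n + (((n - k).toNat + 1 : ℕ) : ℂ) • simpleRoot 1 =
        gridWeight m j (k + ((n - k).toNat + 1 : ℕ)) n := by
      simp only [gridWeight, simpleRoot, Matrix.cons_val_one, Matrix.cons_val_zero]
      push_cast; module
    have := hV.nonneg_of_mem_weights (h1 ▸ h)
    omega

/-- The vector $f_i^{N+1}v$ is singular: $e_i$ kills it because the coefficient $N-N$ vanishes, and
the other $e_j$ commutes with $f_i$. Were it nonzero, its weight would bound all weights, including
the strictly higher $\Lambda$. -/
theorem lower_pow_eq_zero {Lam : Weight} (hV : IsIrreducibleHighestWeight V Lam) {v : V}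
    (hv0 : v ≠ 0) (hv : IsSingular Lam v) {i : Fin 2} {N : ℕ} (hN : Lam (simpleCoroot i) = N) :
    (LieModule.toEnd ℂ AffineSl2 V (lower i) ^ (N + 1)) v = 0 := by
  by_contra hu0
  have P : (isSl2Triple i).HasPrimitiveVectorWith v (N : ℂ) :=
    ⟨hv0, by rw [hv.mem_weightSpace, hN], hv.raise i⟩
  have hne : ∀ j : Fin 2, j ≠ i → ∀ k : ℕ,
      ⁅raise j, (LieModule.toEnd ℂ AffineSl2 V (lower i) ^ k) v⁆ = 0 := by
    intro j hj k
    induction k with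
    | zero => exact hv.raise j
    | succ k ih =>
      rw [pow_succ', Module.End.mul_apply, LieModule.toEnd_apply_apply, leibniz_lie,
        raise_lie_lower_of_ne hj, zero_lie, ih, lie_zero, add_zero]
  have hu : IsSingular (Lam - ((N + 1 : ℕ) : ℂ) • simpleRoot i)
      ((LieModule.toEnd ℂ AffineSl2 V (lower i) ^ (N + 1)) v) := by
    refine ⟨lower_pow_mem_weightSpace hv.mem_weightSpace i _, fun j => ?_⟩
    by_cases hj : j = i
    · subst hj
      rw [P.lie_e_pow_succ_toEnd_f N, sub_self, mul_zero, zero_smul]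
    · exact hne j hj _
  obtain ⟨a, b, hab⟩ := weights_le_of_isSingular hV.irreducible hu0 hu
    (nu := Lam) ⟨v, hv0, hv.mem_weightSpace⟩
  -- The element $\alpha^\vee+2d$ is killed by $\alpha_0$ and isolates the coefficient of
  -- $\alpha_1$; below, $d$ isolates that of $\alpha_0$.
  have h1 := LinearMap.congr_fun hab (1, 0, 2)
  have h2 : simpleRoot 0 (1, 0, 2) = 0 := by simp [simpleRoot, alpha, delta]
  have h3 : simpleRoot 1 (1, 0, 2) = 2 := by simp [simpleRoot, alpha]
  have h4 := LinearMap.congr_fun hab (0, 0, 1)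
  have h5 : simpleRoot 0 (0, 0, 1) = 1 := by simp [simpleRoot, alpha, delta]
  have h6 : simpleRoot 1 (0, 0, 1) = 0 := by simp [simpleRoot, alpha]
  simp only [LinearMap.sub_apply, LinearMap.smul_apply, smul_eq_mul, h2, h3, h5, h6] at h1 h4
  fin_cases i
  · simp only [Fin.zero_eta, h5] at h4
    have : ((N + 1 + a : ℕ) : ℂ) = 0 := by push_cast at h4 ⊢; linear_combination h4
    rw [Nat.cast_eq_zero] at this
    omega
  · simp only [Fin.mk_one, h3] at h1
    have : ((N + 1 + b : ℕ) : ℂ) = 0 := by push_cast at h1 ⊢; linear_combination h1 / 2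
    rw [Nat.cast_eq_zero] at this
    omega

theorem wt_simpleCoroot (hj : j ≤ m) (i : Fin 2) :
    wt m j (simpleCoroot i) = ((![m - j, j] i : ℕ) : ℂ) := by
  fin_cases i <;> simp [wt_apply, simpleCoroot, hj, sub_eq_add_neg]

theorem nilSpace_lower_eq_top (hV : IsIrreducibleHighestWeight V (wt m j)) (hj : j ≤ m)
    (i : Fin 2) : nilSpace (V := V) (lower i) = ⊤ := by
  obtain ⟨v, hv0, hv⟩ := hV.exists_isSingular
  exact lower_nilSpace_eq_top hV.irreducible i hv0
    ⟨_, hV.lower_pow_eq_zero hv0 hv (wt_simpleCoroot hj i)⟩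

theorem reflection_zero_mem (hV : IsIrreducibleHighestWeight V (wt m j)) (hj : j ≤ m) {k n : ℤ}
    (h : gridWeight m j k n ∈ weights V) :
    gridWeight m j (m - j - k) (n + (m - j - 2 * k)) ∈ weights V := by
  rw [← simpleReflection_zero_gridWeight]
  refine reflection_mem_weights 0 (hV.nilSpace_lower_eq_top hj 0) h
    (hV.exists_add_notMem_weights k n 0) (p := m - j - 2 * k) ?_
  rw [gridWeight_apply]; simp [simpleCoroot]; ring

theorem reflection_one_mem (hV : IsIrreducibleHighestWeight V (wt m j)) (hj : j ≤ m) {k n : ℤ}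
    (h : gridWeight m j k n ∈ weights V) : gridWeight m j (-k - j) n ∈ weights V := by
  rw [← simpleReflection_one_gridWeight]
  refine reflection_mem_weights 1 (hV.nilSpace_lower_eq_top hj 1) h
    (hV.exists_add_notMem_weights k n 1) (p := j + 2 * k) ?_
  rw [gridWeight_apply]; simp [simpleCoroot]

/-- The weights are stable under the translations of the Weyl group. -/
theorem translation_mem (hV : IsIrreducibleHighestWeight V (wt m j)) (hj : j ≤ m) {k n : ℤ}
    (h : gridWeight m j k n ∈ weights V) (p : ℤ) :
    gridWeight m j (k + p * m) (n + p * (j + 2 * k) + p ^ 2 * m) ∈ weights V := by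
  induction p using Int.induction_on with
  | zero => simpa using h
  | succ p ih =>
    -- Applying $s_1$ and then $s_0$ is translation by $\alpha$; the opposite order is its inverse.
    convert hV.reflection_zero_mem hj (hV.reflection_one_mem hj ih) using 2 <;> ring
  | pred p ih =>
    convert hV.reflection_one_mem hj (hV.reflection_zero_mem hj ih) using 2 <;> ring

/-- The weights lie in the convex hull of the Weyl group orbits of the weights of the
two strings through the highest weight. -/
theorem le_of_mem_weights (hV : IsIrreducibleHighestWeight V (wt m j)) (hj : j ≤ m) {k n : ℤ}
    (h : gridWeight m j k n ∈ weights V) (p : ℤ) {ε : ℤ} (hε : ε = 0 ∨ ε = 1) :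
    (2 * p + ε) * k + p * j - p * (p + ε) * m ≤ n := by
  -- Translating by $-p$ reduces to the two bounds $n\ge0$ and $k\le n$ below the highest weight,
  -- which give $\varepsilon=0$ and $\varepsilon=1$.
  have h1 := hV.nonneg_of_mem_weights (hV.translation_mem hj h (-p))
  rcases hε with rfl | rfl
  · linarith [h1.1]
  · linarith [h1.2]

theorem string_mem (hV : IsIrreducibleHighestWeight V (wt m j)) (hj : j ≤ m) (i : Fin 2) {r : ℕ}
    (hr : r ≤ ![m - j, j] i) : wt m j - (r : ℂ) • simpleRoot i ∈ weights V := by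
  obtain ⟨v, hv0, hv⟩ := hV.exists_isSingular
  have P : (isSl2Triple i).HasPrimitiveVectorWith v ((![m - j, j] i : ℕ) : ℂ) :=
    ⟨hv0, by rw [hv.mem_weightSpace, wt_simpleCoroot hj], hv.raise i⟩
  exact ⟨_, pow_ne_zero_of_le P hr, lower_pow_mem_weightSpace hv.mem_weightSpace i r⟩

/-- The bound of `le_of_mem_weights` is attained for every `k`. -/
theorem exists_mem_weights (hV : IsIrreducibleHighestWeight V (wt m j)) (hm : 0 < m)
    (hj : j ≤ m) (k : ℤ) : ∃ p ε : ℤ, (ε = 0 ∨ ε = 1) ∧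
      gridWeight m j k ((2 * p + ε) * k + p * j - p * (p + ε) * m) ∈ weights V := by
  have hm' : (0 : ℤ) < m := by exact_mod_cast hm
  -- Division of $k+j$ by $m$ translates $k$ to $q-j\in[-j,m-j)$. This range is covered by the
  -- $\alpha_1$-string (where $n=0$) and the $\alpha_0$-string (where $n=k$) through the highest
  -- weight.
  have h1 := Int.emod_add_mul_ediv (k + j) m
  have h2 := Int.emod_nonneg (k + j) hm'.ne'
  have h3 := Int.emod_lt_of_pos (k + j) hm'
  set q := (k + j) % m
  set p := (k + j) / m
  have hk : k = q - j + p * m := by linarith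
  rcases le_total q j with hq | hq
  · refine ⟨p, 0, Or.inl rfl, ?_⟩
    have h4 : gridWeight m j (q - j) 0 ∈ weights V := by
      have := hV.string_mem hj 1 (r := (j - q).toNat)
        (by simp only [Matrix.cons_val_one, Matrix.cons_val_zero]; omega)
      convert this using 1
      have h5 : (((j - q).toNat : ℕ) : ℂ) = ((j - q : ℤ) : ℂ) := by
        rw [← Int.cast_natCast, Int.toNat_of_nonneg (by omega)]
      rw [h5]
      simp only [gridWeight, simpleRoot, Matrix.cons_val_one, Matrix.cons_val_zero]
      push_cast; module
    convert hV.translation_mem hj h4 p using 2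
    rw [hk]; ring
  · refine ⟨p, 1, Or.inr rfl, ?_⟩
    have h4 : gridWeight m j (q - j) (q - j) ∈ weights V := by
      have := hV.string_mem hj 0 (r := (q - j).toNat)
        (by simp only [Matrix.cons_val_zero]; omega)
      convert this using 1
      have h5 : (((q - j).toNat : ℕ) : ℂ) = ((q - j : ℤ) : ℂ) := by
        rw [← Int.cast_natCast, Int.toNat_of_nonneg (by omega)]
      rw [h5]
      simp only [gridWeight, simpleRoot, Matrix.cons_val_zero]
      push_cast; module
    convert hV.translation_mem hj h4 p using 2
    rw [hk]; ring

end IsIrreducibleHighestWeight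

end Modules

/-! ### Even elements of the Weyl group -/

/-- `g` is the translation `t_{s α}` of `𝔥^*`. -/
def IsTranslation (s : ℤ) (g : Weight ≃ₗ[ℂ] Weight) : Prop :=
  ∀ mu : Weight, g mu = mu + (s * mu (0, 1, 0)) • alpha -
    (s * mu (1, 0, 0) + s ^ 2 * mu (0, 1, 0)) • delta

theorem IsTranslation.mul {s s' : ℤ} {g g' : Weight ≃ₗ[ℂ] Weight} (hg : IsTranslation s g)
    (hg' : IsTranslation s' g') : IsTranslation (s + s') (g * g') := fun mu => by
  rw [LinearEquiv.mul_apply, hg, hg']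
  have h1 : alpha (1, 0, 0) = 2 := by simp [alpha]
  have h2 : alpha (0, 1, 0) = 0 := by simp [alpha]
  have h3 : delta (1, 0, 0) = 0 := by simp [delta]
  have h4 : delta (0, 1, 0) = 0 := by simp [delta]
  simp only [LinearMap.sub_apply, LinearMap.add_apply, LinearMap.smul_apply, h1, h2, h3, h4,
    smul_eq_mul]
  push_cast; module

theorem apply_simpleCoroot_zero (mu : Weight) :
    mu (simpleCoroot 0) = mu (0, 1, 0) - mu (1, 0, 0) := by
  rw [← map_sub]; simp [simpleCoroot]

/-- Modulo $\delta$ the two simple roots are opposite, so a product of two simple reflections has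
trivial finite part. -/
theorem isTranslation_simpleReflection_mul (i j : Fin 2) :
    ∃ s, IsTranslation s (simpleReflection i * simpleReflection j) := by
  have self : ∀ i, simpleReflection i * simpleReflection i = 1 := fun i =>
    LinearEquiv.ext fun mu => Module.involutive_reflection (simpleRoot_simpleCoroot i) mu
  have h1 : alpha (1, 0, 0) = 2 := by simp [alpha]
  have h2 : alpha (0, 1, 0) = 0 := by simp [alpha]
  have h3 : delta (1, 0, 0) = 0 := by simp [delta]
  have h4 : delta (0, 1, 0) = 0 := by simp [delta]
  have h5 : simpleCoroot 1 = (1, 0, 0) := rfl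
  have h6 : simpleRoot 0 = delta - alpha := rfl
  have h7 : simpleRoot 1 = alpha := rfl
  fin_cases i <;> fin_cases j <;> simp only [Fin.zero_eta, Fin.mk_one]
  · exact ⟨0, fun mu => by simp [self]⟩
  · refine ⟨1, fun mu => ?_⟩
    simp only [LinearEquiv.mul_apply, simpleReflection_apply, apply_simpleCoroot_zero, h5, h6, h7,
      LinearMap.sub_apply, LinearMap.smul_apply, smul_eq_mul, h1, h2]
    push_cast; module
  · refine ⟨-1, fun mu => ?_⟩
    simp only [LinearEquiv.mul_apply, simpleReflection_apply, apply_simpleCoroot_zero, h5, h6, h7,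
      LinearMap.sub_apply, LinearMap.smul_apply, smul_eq_mul, h1, h3]
    push_cast; module
  · exact ⟨0, fun mu => by simp [self]⟩

theorem isTranslation_of_even : ∀ l : List (Fin 2), Even l.length →
    ∃ s, IsTranslation s (l.map simpleReflection).prod
  | [], _ => ⟨0, fun mu => by simp⟩
  | [_], h => by simp at h
  | i :: j :: l, h => by
    obtain ⟨s, hs⟩ := isTranslation_simpleReflection_mul i j
    obtain ⟨s', hs'⟩ := isTranslation_of_even l (by
      simpa [Nat.even_add_one] using h)
    refine ⟨s + s', ?_⟩
    rw [List.map_cons, List.map_cons, List.prod_cons, List.prod_cons, ← mul_assoc]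
    exact hs.mul hs'

theorem exists_word (v : weylGroup) :
    ∃ l : List (Fin 2), (l.map simpleReflection).prod = (v : Weight ≃ₗ[ℂ] Weight) := by
  obtain ⟨v, hv⟩ := v
  induction hv using Subgroup.closure_induction with
  | mem x hx => obtain ⟨i, rfl⟩ := hx; exact ⟨[i], by simp⟩
  | one => exact ⟨[], by simp⟩
  | mul x y _ _ hx hy =>
    obtain ⟨l, hl⟩ := hx
    obtain ⟨l', hl'⟩ := hy
    exact ⟨l ++ l', by simpa using congrArg₂ (· * ·) hl hl'⟩
  | inv x _ hx =>
    obtain ⟨l, hl⟩ := hx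
    refine ⟨l.reverse, ?_⟩
    change _ = x⁻¹
    rw [← show _ = x from hl, List.prod_inv_reverse, List.map_map, ← List.map_reverse]
    congr 2

/-- A shortest word has even length and splits into pairs of reflections; multiplicativity of the
sign is not required. -/
theorem isTranslation_of_sign {v : weylGroup} (hv : sign v = 1) :
    ∃ s, IsTranslation s (v : Weight ≃ₗ[ℂ] Weight) := by
  obtain ⟨l, hl⟩ := exists_word v
  obtain ⟨l', hl', hp⟩ := Nat.sInf_mem
    (s := {n : ℕ | ∃ l : List (Fin 2), l.length = n ∧ (l.map simpleReflection).prod = v})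
    ⟨l.length, l, rfl, hl⟩
  rw [← hp]
  refine isTranslation_of_even l' ?_
  rw [hl']
  exact (neg_one_pow_eq_one_iff_even (by norm_num)).1 hv

theorem sign_one : sign 1 = 1 := by
  have : length 1 = 0 := Nat.sInf_eq_zero.2 (Or.inl ⟨[], rfl, rfl⟩)
  rw [sign, this, pow_zero]

/-! ### Comparison of the shifts -/

/-- The difference between the affine bounds of slopes `2 q + ε` at `J + s (m' + m'' + 2)` and
`2 p + ε` at `J` exceeds the `δ`-shift of the translation by `s ≠ 0`, for a suitable `q`. -/
theorem exists_shift_lt {m' m'' j j' j'' J : ℤ} (hm'' : 0 ≤ m'') (hj0 : 0 ≤ j)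
    (hj0'' : 0 ≤ j'') (hj'' : j'' ≤ m'') (hj : j ≤ m' + m'') (hJ : j - j' - j'' = 2 * J)
    (p ε : ℤ) {s : ℤ} (hs : s ≠ 0) :
    ∃ q : ℤ, (2 * p + ε) * J + p * j' - p * (p + ε) * m' +
        (s * (j + 1) + s ^ 2 * (m' + m'' + 2)) <
      (2 * q + ε) * (J + s * (m' + m'' + 2)) + q * j' - q * (q + ε) * m' := by
  -- Here $u$ is the slope of the given line, and $q=p+t$ changes it to $u+2t$; `main` expresses the
  -- excess through $u$, $s$ and $t$.
  obtain ⟨u, hu⟩ : ∃ u, u = 2 * p + ε := ⟨_, rfl⟩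
  have hj' : j' = j - j'' - 2 * J := by linarith
  have main : ∀ t : ℤ, 0 < t * (j - j'' - u * m' - t * m' + 2 * s * (m' + m'' + 2)) +
      u * s * (m' + m'' + 2) - s * (j + 1) - s ^ 2 * (m' + m'' + 2) →
      (2 * p + ε) * J + p * j' - p * (p + ε) * m' +
        (s * (j + 1) + s ^ 2 * (m' + m'' + 2)) <
      (2 * (p + t) + ε) * (J + s * (m' + m'' + 2)) + (p + t) * j' -
        (p + t) * (p + t + ε) * m' := by
    intro t ht
    subst hu hj'
    linarith
  have h1 : ∀ x : ℤ, 1 ≤ x → 0 < x * (m'' + 2) - (j'' + 1) := fun x hx => by nlinarith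
  rcases lt_or_gt_of_ne hs with hs' | hs'
  -- For $t=s$ the excess is $s\bigl((u+s)(m''+2)-(j''+1)\bigr)$. As $0<j''+1<m''+2$, it is positive
  -- if $s<0$, $u\le0$ or if $s>0$, $u>0$.
  · rcases le_or_gt u 0 with hu0 | hu0
    · refine ⟨p + s, main s ?_⟩
      have h2 : (u + s) * (m'' + 2) - (j'' + 1) < 0 := by nlinarith
      have h3 := mul_pos_of_neg_of_neg hs' h2
      linarith
    -- The new slope is $2(s+1)-u$, which agrees with the choice $t=s$ at $u=1$. The excess splits
    -- into a multiple of $u-1$, nonnegative since $j\le m'+m''$, and a positive term.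
    · refine ⟨p + (s + 1 - u), main _ ?_⟩
      obtain ⟨w, rfl⟩ : ∃ w, s = -w := ⟨-s, by ring⟩
      have hw : 1 ≤ w := by omega
      have h2 : 0 ≤ (u - 1) * (w * (m' + m'' + 2) - (j - j'') - (w - 1) * m') :=
        mul_nonneg (by omega) (by nlinarith)
      have h3 : 0 < w * ((w - 1) * (m'' + 2) + j'' + 1) :=
        mul_pos (by omega) (by nlinarith)
      linarith
  · rcases le_or_gt u 0 with hu0 | hu0
    -- The new slope is $2s-u$, which agrees with the choice $t=s$ at $u=0$; the excess is a
    -- nonnegative multiple of $-u$ plus a positive term.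
    · refine ⟨p + (s - u), main _ ?_⟩
      have h2 : 0 ≤ (-u) * (j - j'' + s * (m'' + 2)) := mul_nonneg (by omega) (by nlinarith)
      have h3 : 0 < s * (s * (m'' + 2) - (j'' + 1)) := mul_pos hs' (h1 s (by omega))
      linarith
    · refine ⟨p + s, main s ?_⟩
      have h3 := mul_pos hs' (h1 (u + s) (by omega))
      linarith

/-! ### The main theorem -/

theorem proj_gridWeight_eq_iff (m j : ℕ) (k n J : ℤ) :
    proj (gridWeight m j k n) = wt m j + (J : ℂ) • alpha ↔ k = J := by
  have h : proj (gridWeight m j k n) = gridWeight m j k 0 := by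
    simp only [proj, gridWeight_apply]
    simp only [gridWeight, wt]
    push_cast; module
  have h' : wt m j + (J : ℂ) • alpha = gridWeight m j J 0 := by
    simp [gridWeight]
  rw [h, h']
  exact ⟨fun h => (gridWeight_injective h).1, fun h => by rw [h]⟩

theorem rho_apply (x : Cartan) : rho x = 2 * x.2.1 + x.1 := by
  simp [rho, Lambda0, alpha]

theorem isDecomposition_gridWeight {m' m'' j j' j'' : ℕ} {J k n s S : ℤ}
    (hJ : (j : ℤ) - j' - j'' = 2 * J) {v : weylGroup}
    (hv : IsTranslation s (v : Weight ≃ₗ[ℂ] Weight))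
    (h : IsDecomposition (wt (m' + m'') j) (wt m'' j'') (gridWeight m' j' k n) v S) :
    k = J + s * (m' + m'' + 2) ∧ S = s * (j + 1) + s ^ 2 * (m' + m'' + 2) - n := by
  rw [IsDecomposition, hv] at h
  have h1 := LinearMap.congr_fun h (1, 0, 0)
  have h2 := LinearMap.congr_fun h (0, 0, 1)
  have a1 : alpha (1, 0, 0) = 2 := by simp [alpha]
  have a2 : alpha (0, 0, 1) = 0 := by simp [alpha]
  have d1 : delta (1, 0, 0) = 0 := by simp [delta]
  have d2 : delta (0, 0, 1) = 1 := by simp [delta]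
  simp only [LinearMap.sub_apply, LinearMap.add_apply, LinearMap.smul_apply, smul_eq_mul,
    gridWeight_apply, wt_apply, rho_apply, a1, a2, d1, d2] at h1 h2
  have hJ' : (j : ℂ) - j' - j'' = 2 * J := by exact_mod_cast hJ
  push_cast at h1 h2
  constructor
  · have : (k : ℂ) = J + s * (m' + m'' + 2) := by linear_combination (h1 + hJ') / 2
    exact_mod_cast this
  · have : (S : ℂ) = s * (j + 1) + s ^ 2 * (m' + m'' + 2) - n := by linear_combination -h2
    exact_mod_cast this

end AffineSl2

end

theorem mainTheorem7 (m' m'' j j' j'' : ℕ) (hm' : 0 < m') (hm'' : 0 < m'')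
    (hj' : j' ≤ m') (hj'' : j'' ≤ m'') (hj : j ≤ m' + m'')
    (J : ℤ) (hJ : (j : ℤ) - j' - j'' = 2 * J)
    (V : Type*) [AddCommGroup V] [Module ℂ V] [LieRingModule AffineSl2 V]
    [LieModule ℂ AffineSl2 V]
    (hV : AffineSl2.IsIrreducibleHighestWeight V (AffineSl2.wt m' j')) :
    ∃ Smax : ℤ,
      IsGreatest {S : ℤ | ∃ lam ∈ AffineSl2.tensorSet V (AffineSl2.wt (m' + m'') j)
          (AffineSl2.wt m'' j''), ∃ v : AffineSl2.weylGroup,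
        AffineSl2.IsDecomposition (AffineSl2.wt (m' + m'') j) (AffineSl2.wt m'' j'') lam v S ∧
          AffineSl2.sign v = 1} Smax ∧
      ∀ lam ∈ AffineSl2.tensorSet V (AffineSl2.wt (m' + m'') j) (AffineSl2.wt m'' j''),
        ∀ (v : AffineSl2.weylGroup) (S : ℤ),
          AffineSl2.IsDecomposition (AffineSl2.wt (m' + m'') j) (AffineSl2.wt m'' j'') lam v S →
          AffineSl2.sign v = 1 →
          (S = Smax ↔
            AffineSl2.proj lam = AffineSl2.wt m' j' + (J : ℂ) • AffineSl2.alpha) := by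
  open AffineSl2 in
  -- This line is active at $J$, so $n_0=F(J)$; the maximum will be $-n_0$, attained with $v=1$.
  obtain ⟨p, ε, hε, hmem⟩ := hV.exists_mem_weights hm' hj' J
  set n₀ : ℤ := (2 * p + ε) * J + p * j' - p * (p + ε) * m' with hn₀
  have hadd : ∀ k n r : ℤ, gridWeight m' j' k n + (r : ℂ) • delta =
      gridWeight m' j' k (n - r) := fun k n r => by
    simp only [gridWeight]; push_cast; module
  have hmax : gridWeight m' j' J n₀ ∈ maximalWeights V := by
    refine ⟨hmem, fun r hr h => ?_⟩
    rw [hadd] at h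
    have := hV.le_of_mem_weights hj' h p hε
    omega
  have hdec : IsDecomposition (wt (m' + m'') j) (wt m'' j'') (gridWeight m' j' J n₀) 1 (-n₀) := by
    have hJ' : (J : ℂ) = (j : ℂ) / 2 - j' / 2 - j'' / 2 := by
      have : (j : ℂ) - j' - j'' = 2 * J := by exact_mod_cast hJ
      linear_combination -this / 2
    rw [IsDecomposition, OneMemClass.coe_one, LinearEquiv.coe_one, id, gridWeight, hJ']
    simp only [wt]
    push_cast; module
  have key : ∀ lam ∈ tensorSet V (wt (m' + m'') j) (wt m'' j''), ∀ (v : weylGroup) (S : ℤ),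
      IsDecomposition (wt (m' + m'') j) (wt m'' j'') lam v S → sign v = 1 →
      S ≤ -n₀ ∧ (S = -n₀ ↔ proj lam = wt m' j' + (J : ℂ) • alpha) := by
    rintro lam ⟨⟨hlam, hlam'⟩, -⟩ v S hS hv
    obtain ⟨s, hs⟩ := isTranslation_of_sign hv
    obtain ⟨k, n, -, -, rfl⟩ := hV.exists_gridWeight hlam
    obtain ⟨hk, rfl⟩ := isDecomposition_gridWeight hJ hs hS
    rw [proj_gridWeight_eq_iff]
    rcases eq_or_ne s 0 with rfl | hs0
    · have hkJ : k = J := by simpa using hk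
      subst hkJ
      have h1 := hV.le_of_mem_weights hj' hlam p hε
      have h2 : n ≤ n₀ := by
        by_contra! h
        -- If $n>n_0$, raising by $(n-n_0)\delta$ would reach the known weight over $J$, against
        -- $\delta$-maximality.
        refine hlam' (n - n₀) (by omega) ?_
        rw [hadd, sub_sub_cancel]
        exact hmem
      have : n = n₀ := le_antisymm h2 h1
      simp [this]
    · obtain ⟨q, hq⟩ := exists_shift_lt (m' := m') (m'' := m'') (j := j) (j' := j') (j'' := j'')
        (by positivity) (by positivity) (by positivity) (by exact_mod_cast hj'')
        (by exact_mod_cast hj) hJ p ε hs0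
      -- Only the lower bound for $n$ is needed when $s\ne0$; it makes $S$ strictly smaller, while
      -- $k\ne J$ excludes the projection condition.
      have h1 := hV.le_of_mem_weights hj' hlam q hε
      rw [hk] at h1
      have hlt : s * (j + 1) + s ^ 2 * (m' + m'' + 2) - n < -n₀ := by linarith
      refine ⟨hlt.le, iff_of_false hlt.ne fun h => ?_⟩
      have h2 : s * ((m' : ℤ) + m'' + 2) = 0 := by linarith
      exact mul_ne_zero hs0 (by positivity) h2
  refine ⟨-n₀, ⟨⟨_, ⟨hmax, 1, -n₀, hdec⟩, 1, hdec, sign_one⟩, ?_⟩, ?_⟩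
  · rintro S ⟨lam, hlam, v, hS, hv⟩
    exact (key lam hlam v S hS hv).1
  · exact fun lam hlam v S hS hv => (key lam hlam v S hS hv).2
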